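/- A server stores $N\ge 1$ files of $F$ independent uniformly random bits each and is connected by a shared error-free link to $K$ users, each with a cache of at most $MF$ bits, where $M\ge 0$ is real. In the placement phase each cache is filled with an arbitrary function of all files. In the delivery phase user $k$ requests file $d_k$, the requests being i.i.d. with $\Pr(d_k=n)=p_n$; knowing $d=(d_1,\dots,d_K)$, the server sends a message of $\ell_d$ bits (a function of the files), from which, together with its cache, each user must recover its requested file. A rate $R$ is achievable in expectation (respectively, as a peak rate) if for every $\varepsilon>0$ and all sufficiently large $F$ there is a scheme with $\mathbb E(\ell_d)\le RF$ (respectively, $\ell_d\le RF$ for every $d$) for which, for every $d$, the probability that some user fails to decode is at most $\varepsilon$. Let $R^\star(M,\mathcal N,K)$ and $R_{\mathrm{peak}}^\star(M,N,K)$ be the infima of the rates achievable in expectation and as a peak rate, respectively. Let $$R(M,N,K)=K\Bigl(1-\frac MN\Bigr)\min\Bigl\{\frac{N}{KM}\Bigl(1-\Bigl(1-\frac MN\Bigr)^K\Bigr),\frac NK\Bigr\}\quad (0<M\le N),$$ $R(0,N,K)=\min\{N,K\}$, and $R(M,N,K)=0$ for $M>N$. The coded caching scheme is the following. Placement: each user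 caches, for each file, the bits at a uniformly random set of $\min\{\lfloor MF/N\rfloor,F\}$ positions, independently over users and files. Delivery: the server uses whichever of the following two procedures sends fewer bits. (i) For every nonempty set $S$ of users it sends the XOR of the zero-padded vectors $V_{k,S\setminus\{k\}}$, $k\in S$, where $V_{k,S'}$ consists of the bits of file $d_k$ that are cached at every user in $S'$ and at no other user. (ii) For every requested file it sends $T$ uniformly random linear combinations over $\mathbb F_2$ of the bits of this file. There is a universal constant $c>0$ such that for all $N\ge 1$, $K$, $M\ge 0$ and uniform popularities $p_1=\dots=p_N=1/N$: 1. $\frac1c R(M,N,K)\le R^\star(M,\mathcal N,K)\le R(M,N,K)$. 2. Peak and expected optimal rates agree up to a constant: $R^\star(M,\mathcal N,K)\le R_{\mathrm{peak}}^\star(M,N,K)\le c\,R^\star(M,\mathcal N,K)$, and $R_{\mathrm{peak}}^\star(M,N,K)\le R(M,N,K)$. 3. The coded caching scheme is within a constant factor of optimal: for every $\varepsilon>0$ and all sufficiently large $F$, for a suitable number $T$, with probability at least $1-\varepsilon$ over the random placement and the random coefficients, the scheme satisfies the memory constraint, all users decode for all demands and all file contents, the load is at most $(R(M,N,K)+\varepsilon)F$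 for every demand, and the expected load over the random demands is at most $c\,R^\star(M,\mathcal N,K)\,F$. -/

import Mathlib

namespace CodedCaching

open Filter Topology

/-- A bit; addition is XOR. -/
abbrev Bit : Type := ZMod 2

/-- The contents of `N` files of `F` bits each. -/
abbrev Library (N F : ℕ) : Type := Fin N → Fin F → Bit

/-- A demand tuple: user `k` requests file `d k`. -/
abbrev Demand (N K : ℕ) : Type := Fin K → Fin N

/-- Probability of the event `E` under the uniform distribution on a finite type. -/
noncomputable def uniformProb (Ω : Type) [Fintype Ω] (E : Ω → Prop) : ℝ :=
  (Nat.card {ω : Ω // E ω} : ℝ) / (Fintype.card Ω : ℝ)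

/-- Placement and delivery functions for `N` files of `F` bits and `K` users.  The cache of user `k`
holds an arbitrary function of all the files, namely one bit for every index in `CacheIdx k`; for the
demand tuple `d` the server sends one bit for every index in `MsgIdx d`. -/
structure Scheme (N K F : ℕ) where
  CacheIdx : Fin K → Type
  fintypeCache : ∀ k, Fintype (CacheIdx k)
  MsgIdx : Demand N K → Type
  fintypeMsg : ∀ d, Fintype (MsgIdx d)
  cache : ∀ k, Library N F → CacheIdx k → Bit
  msg : ∀ d, Library N F → MsgIdx d → Bit

attribute [instance] Scheme.fintypeCache Scheme.fintypeMsg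

namespace Scheme

variable {N K F : ℕ}

/-- Every cache has size at most `M F` bits. -/
def FitsMemory (s : Scheme N K F) (M : ℝ) : Prop :=
  ∀ k, (Fintype.card (s.CacheIdx k) : ℝ) ≤ M * F

/-- The number of bits sent over the shared link for the demand tuple `d`. -/
def load (s : Scheme N K F) (d : Demand N K) : ℕ := Fintype.card (s.MsgIdx d)

/-- The expected number of bits sent when the users request files independently of each other, file
`n` with probability `p n`. -/
noncomputable def expectedLoad (s : Scheme N K F) (p : Fin N → ℝ) : ℝ :=
  ∑ d : Demand N K, (∏ k, p (d k)) * (s.load d : ℝ)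

/-- Decoding functions: user `k` estimates its requested file from the message and its cache. -/
def Decoder (s : Scheme N K F) : Type :=
  ∀ (d : Demand N K) (k : Fin K), (s.MsgIdx d → Bit) → (s.CacheIdx k → Bit) → Fin F → Bit

/-- The probability, over independent uniformly distributed files, that some user fails to recover its
requested file when the demand tuple is `d`. -/
noncomputable def errorProb (s : Scheme N K F) (D : s.Decoder) (d : Demand N K) : ℝ :=
  uniformProb (Library N F) fun W => ∃ k, D d k (s.msg d W) (s.cache k W) ≠ W (d k)

/-- For all demands and all file contents, every user can recover its requested file. -/
def Decodable (s : Scheme N K F) : Prop :=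
  ∃ D : s.Decoder, ∀ d W k, D d k (s.msg d W) (s.cache k W) = W (d k)

end Scheme

/-- Expected rate `R` is achievable with normalized cache size `M` and popularities `p`: for every
`ε > 0` and every large enough file size `F`, there is a scheme with caches of at most `M F` bits and
expected load at most `R F` bits whose error probability is at most `ε` for every demand tuple. -/
def AchievableExpected {N : ℕ} (M : ℝ) (p : Fin N → ℝ) (K : ℕ) (R : ℝ) : Prop :=
  ∀ ε : ℝ, 0 < ε → ∀ᶠ F : ℕ in atTop, ∃ (s : Scheme N K F) (D : s.Decoder),
    s.FitsMemory M ∧ s.expectedLoad p ≤ R * F ∧ ∀ d, s.errorProb D d ≤ ε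

/-- Peak rate `R` is achievable with normalized cache size `M`: the same with load at most `R F` bits
for every demand tuple. -/
def AchievablePeak (M : ℝ) (N K : ℕ) (R : ℝ) : Prop :=
  ∀ ε : ℝ, 0 < ε → ∀ᶠ F : ℕ in atTop, ∃ (s : Scheme N K F) (D : s.Decoder),
    s.FitsMemory M ∧ (∀ d, (s.load d : ℝ) ≤ R * F) ∧ ∀ d, s.errorProb D d ≤ ε

/-- The optimal expected rate `R⋆(M, 𝒩, K)` for file popularities `p`. -/
noncomputable def optExpectedRate {N : ℕ} (M : ℝ) (p : Fin N → ℝ) (K : ℕ) : ℝ :=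
  sInf {R : ℝ | AchievableExpected M p K R}

/-- The optimal peak rate. -/
noncomputable def optPeakRate (M : ℝ) (N K : ℕ) : ℝ :=
  sInf {R : ℝ | AchievablePeak M N K R}

/-- The function `R(M, N, K)`, for `M ≥ 0`. -/
noncomputable def codedRate (M : ℝ) (N K : ℕ) : ℝ :=
  if M = 0 then min (N : ℝ) K
  else if M ≤ N then
    K * (1 - M / N) * min (N / (K * M) * (1 - (1 - M / N) ^ K)) ((N : ℝ) / K)
  else 0

/-! ### The coded caching scheme -/

/-- The number of bits of each file that each user caches: `M F / N`, rounded down, and the whole file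
if `M > N`. -/
noncomputable def cachedBits (M : ℝ) (N F : ℕ) : ℕ := min ⌊M * F / N⌋₊ F

/-- The possible outcomes of the placement phase: user `k` caches the bits of file `n` at the
positions `P k n`, a set of exactly `m` positions.  The uniform distribution on this type makes the
sets `P k n` uniform and independent over `k` and `n`. -/
abbrev Placement (N K F m : ℕ) : Type := Fin K → Fin N → {C : Finset (Fin F) // C.card = m}

/-- Coefficients of `T` linear combinations of the bits of each file. -/
abbrev Coeffs (N F T : ℕ) : Type := Fin N → Fin T → Fin F → Bit

section Coded

variable {N K F m T : ℕ}

/-- The positions of the bits of the file requested by user `k` that are cached at every user in `S`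
and at no user outside `S`. -/
def exclusiveBits (P : Placement N K F m) (d : Demand N K) (k : Fin K) (S : Finset (Fin K)) :
    Finset (Fin F) :=
  Finset.univ.filter fun i => ∀ j, i ∈ (P j (d k)).1 ↔ j ∈ S

/-- The vector `V_{k,S}` of the bits at these positions, in increasing order of position, padded with
zeros. -/
def subfile (P : Placement N K F m) (d : Demand N K) (W : Library N F) (k : Fin K)
    (S : Finset (Fin K)) (j : ℕ) : Bit :=
  if h : j < (exclusiveBits P d k S).card then
    W (d k) ((exclusiveBits P d k S).orderEmbOfFin rfl ⟨j, h⟩)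
  else 0

/-- The length of the XOR of the vectors `V_{k, S \ {k}}`, `k ∈ S` (it is `0` for `S = ∅`). -/
def xorLength (P : Placement N K F m) (d : Demand N K) (S : Finset (Fin K)) : ℕ :=
  S.sup fun k => (exclusiveBits P d k (S.erase k)).card

/-- Bits sent by the first delivery procedure: one XOR for every set `S` of users. -/
abbrev XorIdx (P : Placement N K F m) (d : Demand N K) : Type :=
  Σ S : Finset (Fin K), Fin (xorLength P d S)

def xorMsg (P : Placement N K F m) (d : Demand N K) (W : Library N F) (x : XorIdx P d) : Bit :=
  ∑ k ∈ x.1, subfile P d W k (x.1.erase k) x.2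

/-- Bits sent by the second delivery procedure: `T` linear combinations of the bits of each requested
file. -/
abbrev LinIdx (d : Demand N K) (T : ℕ) : Type := {n : Fin N // ∃ k, d k = n} × Fin T

def linMsg (A : Coeffs N F T) (d : Demand N K) (W : Library N F) (x : LinIdx d T) : Bit :=
  ∑ i, A x.1.1 x.2 i * W x.1.1 i

/-- The first delivery procedure is no longer than the second. -/
abbrev UseXor (P : Placement N K F m) (d : Demand N K) (T : ℕ) : Prop :=
  Fintype.card (XorIdx P d) ≤ Fintype.card (LinIdx d T)

/-- The coded caching scheme, for the outcome `P` of the random placement and the random coefficients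
`A`: user `k` stores its bits of every file, and for each demand tuple the server uses the delivery
procedure with the smaller load. -/
def codedScheme (P : Placement N K F m) (A : Coeffs N F T) : Scheme N K F where
  CacheIdx k := Σ n : Fin N, {i : Fin F // i ∈ (P k n).1}
  fintypeCache _ := inferInstance
  MsgIdx d := {_x : XorIdx P d // UseXor P d T} ⊕ {_x : LinIdx d T // ¬ UseXor P d T}
  fintypeMsg _ := inferInstance
  cache _ W x := W x.1 x.2.1
  msg d W := Sum.elim (fun x => xorMsg P d W x.1) (fun x => linMsg A d W x.1)

end Coded

end CodedCaching

namespace CodedCaching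

/-! ### Uniform probability on finite types -/

/-! Converse. Fix a set `U` of `s` users and a set `J` of `b` shifts of the file indices modulo `N`.
For a uniform demand `d`, every shifted demand `d + j` is again uniform, so sending the messages for
all `j ∈ J` costs `b R F` bits on average. Together with the caches of `U` they reveal every file `d
k + j`, on average `N (1 - (1 - b/N)^s)` files. Hence `N (1 - (1 - b/N)^s) ≤ s M + b R`
(`AchievableExpected.cutset`). Taking `s` proportional to `codedRate` and `b` about `N / s` makes
the left side at least `N / 2`, and this bounds `codedRate` by `72 R` (`codedRate_le_of_cutset`).

Achievability. With `q = min (M / N) 1`, the two delivery procedures have asymptotic loads `xorRate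
K q` and `N (1 - q)` per bit of a file, and `codedRate` is their minimum (`codedRate_eq_min`).
Chebyshev's inequality controls the XOR lengths for a random placement (`uniformProb_atypical_le`).
A union bound shows that slightly more than `F - m` random combinations per file suffice when `m` of
its bits are cached (`uniformProb_degenerate_le`). These bounds are uniform in the demand, so they
concern the peak rate, which dominates the expected rate. The expected rate, the peak rate and the
load of the scheme thus all lie within constant factors of `codedRate`. -/

open Classical in
theorem uniformProb_eq_sum (Ω : Type) [Fintype Ω] (E : Ω → Prop) :
    uniformProb Ω E = (∑ ω, if E ω then (1 : ℝ) else 0) / Fintype.card Ω := by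
  rw [uniformProb, Nat.card_eq_fintype_card, Fintype.card_subtype, Finset.sum_boole]

theorem uniformProb_nonneg (Ω : Type) [Fintype Ω] (E : Ω → Prop) : 0 ≤ uniformProb Ω E := by
  unfold uniformProb; positivity

theorem uniformProb_true (Ω : Type) [Fintype Ω] [Nonempty Ω] :
    uniformProb Ω (fun _ => True) = 1 := by
  classical
  simp [uniformProb_eq_sum]

theorem uniformProb_mono {Ω : Type} [Fintype Ω] {E E' : Ω → Prop} (h : ∀ ω, E ω → E' ω) :
    uniformProb Ω E ≤ uniformProb Ω E' := by
  classical
  rw [uniformProb_eq_sum, uniformProb_eq_sum]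
  gcongr with ω
  by_cases h1 : E ω
  · simp [h1, h ω h1]
  · simp only [h1, if_false]
    split_ifs <;> norm_num

theorem uniformProb_not {Ω : Type} [Fintype Ω] [Nonempty Ω] (E : Ω → Prop) :
    uniformProb Ω (fun ω => ¬ E ω) = 1 - uniformProb Ω E := by
  classical
  rw [uniformProb_eq_sum, uniformProb_eq_sum]
  have hΩ : (Fintype.card Ω : ℝ) ≠ 0 := by simp
  rw [eq_sub_iff_add_eq, ← add_div, ← Finset.sum_add_distrib, div_eq_one_iff_eq hΩ]
  trans ∑ _ω : Ω, (1 : ℝ)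
  · refine Finset.sum_congr rfl fun ω _ => ?_
    by_cases h : E ω <;> simp [h]
  · simp

theorem uniformProb_or_le {Ω : Type} [Fintype Ω] (E E' : Ω → Prop) :
    uniformProb Ω (fun ω => E ω ∨ E' ω) ≤ uniformProb Ω E + uniformProb Ω E' := by
  classical
  simp only [uniformProb_eq_sum]
  rw [← add_div, ← Finset.sum_add_distrib]
  gcongr with ω
  by_cases h : E ω <;> by_cases h' : E' ω <;> simp [h, h']

theorem uniformProb_exists_le {Ω ι : Type} [Fintype Ω] (s : Finset ι) (E : ι → Ω → Prop) :
    uniformProb Ω (fun ω => ∃ i ∈ s, E i ω) ≤ ∑ i ∈ s, uniformProb Ω (E i) := by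
  classical
  simp only [uniformProb_eq_sum]
  rw [← Finset.sum_div, Finset.sum_comm]
  gcongr with ω
  split_ifs with h
  · obtain ⟨i, hi, hE⟩ := h
    calc (1 : ℝ) = if E i ω then 1 else 0 := by simp [hE]
      _ ≤ _ := Finset.single_le_sum (f := fun i => if E i ω then (1 : ℝ) else 0)
          (fun j _ => by positivity) hi
  · positivity

/-- Independence of the coordinates of a uniformly random tuple. -/
theorem uniformProb_pi {ι : Type} [Fintype ι] [DecidableEq ι] {α : ι → Type}
    [∀ i, Fintype (α i)] (E : ∀ i, α i → Prop) :
    uniformProb (∀ i, α i) (fun f => ∀ i, E i (f i)) = ∏ i, uniformProb (α i) (E i) := by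
  unfold uniformProb
  rw [Nat.card_congr (Equiv.subtypePiEquivPi (p := fun {i} => E i)), Nat.card_pi, Fintype.card_pi]
  push_cast
  rw [Finset.prod_div_distrib]

theorem uniformProb_apply {ι : Type} [Fintype ι] [DecidableEq ι] {α : Type} [Fintype α]
    [Nonempty α] (i : ι) (E : α → Prop) :
    uniformProb (ι → α) (fun f => E (f i)) = uniformProb α E := by
  have h := uniformProb_pi (ι := ι) (α := fun _ => α) (fun j x => j = i → E x)
  simp only [forall_eq] at h
  rw [h, Finset.prod_eq_single i]
  · simp
  · intro j _ hj
    simp [hj, uniformProb_true]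
  · simp

theorem sum_card_filter_eq {Ω ι : Type} [Fintype Ω] [Nonempty Ω] (s : Finset ι)
    (E : Ω → ι → Prop) [∀ ω, DecidablePred (E ω)] :
    ∑ ω, ((s.filter (E ω)).card : ℝ) =
      Fintype.card Ω * ∑ i ∈ s, uniformProb Ω (fun ω => E ω i) := by
  classical
  have hΩ : (Fintype.card Ω : ℝ) ≠ 0 := by simp
  simp only [uniformProb_eq_sum]
  rw [← Finset.sum_div, mul_div_cancel₀ _ hΩ, Finset.sum_comm]
  refine Finset.sum_congr rfl fun ω _ => ?_
  rw [← Finset.sum_boole]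
  refine Finset.sum_congr rfl fun i _ => ?_
  congr

theorem uniformProb_prod {α β : Type} [Fintype α] [Fintype β] (E : α × β → Prop) :
    uniformProb (α × β) E =
      (∑ a, uniformProb β (fun b => E (a, b))) / Fintype.card α := by
  classical
  simp only [uniformProb_eq_sum]
  rw [Fintype.sum_prod_type, Fintype.card_prod, Nat.cast_mul, ← Finset.sum_div, div_div,
    mul_comm (Fintype.card α : ℝ)]

/-- Used with `α` the placements and `β` the coefficients: the second failure event depends on the
placement, but its probability is bounded for each placement separately. -/
theorem uniformProb_prod_ge {α β : Type} [Fintype α] [Fintype β] [Nonempty α] [Nonempty β]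
    {B : α → Prop} {B' : α → β → Prop} {E : α × β → Prop} {x y : ℝ}
    (hB : uniformProb α B ≤ x) (hB' : ∀ a, uniformProb β (B' a) ≤ y)
    (hE : ∀ a b, ¬ B a → ¬ B' a b → E (a, b)) :
    1 - (x + y) ≤ uniformProb (α × β) E := by
  classical
  have hα : (0 : ℝ) < Fintype.card α := by exact_mod_cast Fintype.card_pos
  have h1 : uniformProb (α × β) (fun ω => B ω.1) ≤ x := by
    refine le_trans (le_of_eq ?_) hB
    rw [uniformProb_prod, uniformProb_eq_sum]
    congr 1
    refine Finset.sum_congr rfl fun a _ => ?_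
    by_cases h : B a
    · simpa [h] using uniformProb_true β
    · simp [h, uniformProb]
  have h2 : uniformProb (α × β) (fun ω => B' ω.1 ω.2) ≤ y := by
    rw [uniformProb_prod, div_le_iff₀ hα]
    refine (Finset.sum_le_card_nsmul _ _ y fun a _ => hB' a).trans_eq ?_
    rw [Finset.card_univ, nsmul_eq_mul, mul_comm]
  have h3 : uniformProb (α × β) (fun ω => ¬ E ω) ≤ x + y := by
    have hor : uniformProb (α × β) (fun ω => B ω.1 ∨ B' ω.1 ω.2) ≤ x + y :=
      (uniformProb_or_le (fun ω : α × β => B ω.1) fun ω => B' ω.1 ω.2).trans (add_le_add h1 h2)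
    refine (uniformProb_mono ?_).trans hor
    rintro ⟨a, b⟩ h
    by_contra hc
    exact h (hE a b (fun hb => hc (Or.inl hb)) (fun hb => hc (Or.inr hb)))
  rw [uniformProb_not] at h3
  linarith

/-! ### The converse -/

/-- If the caches of the users in `U` and the messages for the demand tuples `dem j`, `j ∈ J`,
suffice to recover the files in `A`, then they hold at least `|A| F - 1` bits. -/
theorem Scheme.card_mul_le {N K F : ℕ} (s : Scheme N K F) (D : s.Decoder) {ι : Type}
    (J : Finset ι) (dem : ι → Demand N K) (U : Finset (Fin K)) (A : Finset (Fin N))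
    (hA : ∀ n ∈ A, ∃ j ∈ J, ∃ k ∈ U, dem j k = n) {ε : ℝ} (hJ : J.card * ε ≤ 1 / 2)
    (hε : ∀ d, s.errorProb D d ≤ ε) :
    A.card * F ≤ ∑ k ∈ U, Fintype.card (s.CacheIdx k) + ∑ j ∈ J, s.load (dem j) + 1 := by
  classical
  -- Libraries on which all the messages in question decode correctly. They make up at least half of
  -- all libraries, and this half costs the one extra bit in the bound.
  let Good : Library N F → Prop := fun W =>
    ¬ ∃ j ∈ J, ∃ k, D (dem j) k (s.msg (dem j) W) (s.cache k W) ≠ W (dem j k)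
  have hgood : 1 / 2 ≤ uniformProb (Library N F) Good := by
    have h : uniformProb (Library N F) (fun W => ∃ j ∈ J,
        ∃ k, D (dem j) k (s.msg (dem j) W) (s.cache k W) ≠ W (dem j k)) ≤ 1 / 2 := by
      refine (uniformProb_exists_le J _).trans ?_
      calc _ ≤ ∑ _j ∈ J, ε := Finset.sum_le_sum fun j _ => hε (dem j)
        _ = J.card * ε := by simp
        _ ≤ 1 / 2 := hJ
    rw [uniformProb_not]
    linarith
  -- Caches, messages and the files outside `A` together determine a good library, so counting bits
  -- gives the bound.
  let I : Type := ((Σ k : U, s.CacheIdx k) ⊕ (Σ j : J, s.MsgIdx (dem j))) ⊕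
    ({n : Fin N // n ∉ A} × Fin F)
  let f : {W // Good W} → I → Bit := fun W => Sum.elim
    (Sum.elim (fun x => s.cache x.1 W.1 x.2) (fun x => s.msg (dem x.1) W.1 x.2))
    (fun x => W.1 x.1 x.2)
  have hf : Function.Injective f := by
    rintro ⟨W, hW⟩ ⟨W', hW'⟩ h
    apply Subtype.ext
    funext n
    by_cases hn : n ∈ A
    · obtain ⟨j, hj, k, hk, rfl⟩ := hA n hn
      simp only [Good] at hW hW'
      push Not at hW hW'
      have hc : s.cache k W = s.cache k W' :=
        funext fun x => congrFun h (Sum.inl (Sum.inl ⟨⟨k, hk⟩, x⟩))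
      have hm : s.msg (dem j) W = s.msg (dem j) W' :=
        funext fun x => congrFun h (Sum.inl (Sum.inr ⟨⟨j, hj⟩, x⟩))
      change W (dem j k) = W' (dem j k)
      rw [← hW j hj k, ← hW' j hj k, hc, hm]
    · exact funext fun i => congrFun h (Sum.inr (⟨n, hn⟩, i))
  have hcard := Fintype.card_le_of_injective f hf
  have hI : Fintype.card I = ∑ k ∈ U, Fintype.card (s.CacheIdx k) + ∑ j ∈ J, s.load (dem j) +
      (N - A.card) * F := by
    simp only [I, Fintype.card_sum, Fintype.card_sigma, Fintype.card_prod, Fintype.card_fin,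
      Fintype.card_subtype_compl, Fintype.card_coe, Scheme.load]
    rw [Finset.sum_coe_sort U (fun k => Fintype.card (s.CacheIdx k)),
      Finset.sum_coe_sort J (fun j => Fintype.card (s.MsgIdx (dem j)))]
  have hL : Fintype.card (Library N F) = 2 ^ (N * F) := by
    simp [mul_comm N F, pow_mul]
  rw [Fintype.card_fun, ZMod.card, hI] at hcard
  rw [uniformProb, Nat.card_eq_fintype_card, hL, le_div_iff₀ (by positivity)] at hgood
  have h2 : 2 ^ (N * F) ≤ 2 * Fintype.card {W // Good W} := by
    have : ((2 ^ (N * F) : ℕ) : ℝ) ≤ ((2 * Fintype.card {W // Good W} : ℕ) : ℝ) := by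
      push_cast at hgood ⊢; linarith
    exact_mod_cast this
  have h3 := h2.trans (Nat.mul_le_mul_left 2 hcard)
  rw [← pow_succ', Nat.pow_le_pow_iff_right (by norm_num)] at h3
  have hAN : A.card ≤ N := by simpa using A.card_le_univ
  have : (N - A.card) * F + A.card * F = N * F := by rw [← add_mul, Nat.sub_add_cancel hAN]
  omega

theorem expectedLoad_uniform {N K F : ℕ} (s : Scheme N K F) :
    s.expectedLoad (fun _ => (1 : ℝ) / N) = (∑ d, (s.load d : ℝ)) / N ^ K := by
  simp only [Scheme.expectedLoad, Finset.prod_const, Finset.card_univ, Fintype.card_fin]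
  rw [← Finset.mul_sum, div_pow, one_pow, one_div, div_eq_inv_mul]

/-- The expected number of files `n` of the form `d k + j` with `k ∈ U`, `j ∈ J`. -/
theorem sum_card_shifts {N K : ℕ} [NeZero N] (U : Finset (Fin K)) (J : Finset (Fin N)) :
    ∑ d : Demand N K, (((Finset.univ : Finset (Fin N)).filter
        fun n => ∃ j ∈ J, ∃ k ∈ U, d k + j = n).card : ℝ) =
      N ^ K * (N * (1 - (1 - J.card / N) ^ U.card)) := by
  classical
  have hN : (N : ℝ) ≠ 0 := by exact_mod_cast NeZero.ne N
  rw [sum_card_filter_eq]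
  have h : ∀ n : Fin N, uniformProb (Demand N K) (fun d => ∃ j ∈ J, ∃ k ∈ U, d k + j = n) =
      1 - (1 - J.card / N) ^ U.card := by
    intro n
    rw [eq_sub_iff_add_eq, ← eq_sub_iff_add_eq', ← uniformProb_not]
    have h1 := uniformProb_pi (ι := Fin K) (α := fun _ => Fin N)
      (fun k x => k ∈ U → ¬ ∃ j ∈ J, x + j = n)
    have h2 : (fun d : Demand N K => ¬ ∃ j ∈ J, ∃ k ∈ U, d k + j = n) =
        fun d => ∀ k, k ∈ U → ¬ ∃ j ∈ J, d k + j = n := by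
      funext d; apply propext; push Not
      exact ⟨fun h k hk j hj => h j hj k hk, fun h j hj k hk => h k hk j hj⟩
    rw [h2, h1]
    have h3 : ∀ k, uniformProb (Fin N) (fun x => k ∈ U → ¬ ∃ j ∈ J, x + j = n) =
        if k ∈ U then 1 - (J.card : ℝ) / N else 1 := by
      intro k
      split_ifs with hk
      · simp only [hk, forall_const]
        rw [uniformProb_not]
        congr 1
        rw [uniformProb, Nat.card_eq_fintype_card, Fintype.card_subtype, Fintype.card_fin]
        congr 2
        rw [← Finset.card_image_of_injective J (f := fun j => n - j)
          (fun a b h => sub_right_injective h)]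
        congr 1
        ext x
        simp only [Finset.mem_filter, Finset.mem_univ, true_and, Finset.mem_image]
        exact exists_congr fun j => and_congr_right fun _ => by
          rw [← eq_sub_iff_add_eq, eq_comm]
      · simp [hk, uniformProb_true]
    simp only [h3]
    rw [Finset.prod_ite_mem, Finset.univ_inter, Finset.prod_const]
  simp only [h, Finset.sum_const, Finset.card_univ, nsmul_eq_mul, Fintype.card_pi,
    Fintype.card_fin, Finset.prod_const, Nat.cast_pow]

/-- A cut-set bound for the expected rate under uniform popularities. -/
theorem AchievableExpected.cutset {N K : ℕ} [NeZero N] {M R : ℝ}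
    (h : AchievableExpected M (fun _ : Fin N => (1 : ℝ) / N) K R)
    (U : Finset (Fin K)) (J : Finset (Fin N)) :
    N * (1 - (1 - (J.card : ℝ) / N) ^ U.card) ≤ U.card * M + J.card * R := by
  classical
  have hN : (0 : ℝ) < N := by exact_mod_cast NeZero.pos N
  by_contra! hlt
  set C : ℝ := N * (1 - (1 - (J.card : ℝ) / N) ^ U.card) - (U.card * M + J.card * R) with hC
  have hCpos : 0 < C := by rw [hC]; linarith
  -- This tolerance keeps the total error over `J` at most `1/2`, also for empty `J`; `F > 1 / C`
  -- makes the gap exceed the lost bit.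
  have hev := (h (1 / (2 * (J.card + 1))) (by positivity)).and
    (Filter.eventually_gt_atTop ⌈1 / C⌉₊)
  obtain ⟨F, ⟨s, D, hM, hR, hε⟩, hF⟩ := hev.exists
  have hF1 : 1 < C * F := by
    have : 1 / C < F := (Nat.le_ceil _).trans_lt (by exact_mod_cast hF)
    rwa [div_lt_iff₀' hCpos] at this
  have hJ : (J.card : ℝ) * (1 / (2 * (J.card + 1))) ≤ 1 / 2 := by
    rw [mul_one_div, div_le_div_iff₀ (by positivity) (by norm_num)]; linarith
  have hd : ∀ d : Demand N K, (((Finset.univ : Finset (Fin N)).filter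
        fun n => ∃ j ∈ J, ∃ k ∈ U, d k + j = n).card : ℝ) * F ≤
      U.card * (M * F) + ∑ j ∈ J, (s.load (fun k => d k + j) : ℝ) + 1 := by
    intro d
    have h1 := s.card_mul_le D J (fun j k => d k + j) U
      (Finset.univ.filter fun n => ∃ j ∈ J, ∃ k ∈ U, d k + j = n) (by simp) hJ hε
    have h2 : (∑ k ∈ U, (Fintype.card (s.CacheIdx k) : ℝ)) ≤ U.card * (M * F) := by
      calc _ ≤ ∑ _k ∈ U, M * F := Finset.sum_le_sum fun k _ => hM k
        _ = _ := by simp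
    have h3 : (((Finset.univ : Finset (Fin N)).filter
        fun n => ∃ j ∈ J, ∃ k ∈ U, d k + j = n).card : ℝ) * F ≤
        ∑ k ∈ U, (Fintype.card (s.CacheIdx k) : ℝ) +
          ∑ j ∈ J, (s.load (fun k => d k + j) : ℝ) + 1 := by exact_mod_cast h1
    linarith
  have hsum := Finset.sum_le_sum fun d (_ : d ∈ (Finset.univ : Finset (Demand N K))) => hd d
  rw [← Finset.sum_mul, sum_card_shifts, Finset.sum_add_distrib, Finset.sum_add_distrib,
    Finset.sum_comm] at hsum
  -- Shifting permutes the demands. This is where uniform popularity is needed.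
  have hshift : ∀ j : Fin N, ∑ d : Demand N K, (s.load (fun k => d k + j) : ℝ) =
      ∑ d, (s.load d : ℝ) := fun j =>
    Equiv.sum_comp (Equiv.piCongrRight fun _ : Fin K => Equiv.addRight j)
      (fun d : Demand N K => (s.load d : ℝ))
  rw [expectedLoad_uniform, div_le_iff₀ (by positivity)] at hR
  simp only [hshift, Finset.sum_const, Finset.card_univ, nsmul_eq_mul, Fintype.card_pi,
    Fintype.card_fin, Finset.prod_const, Nat.cast_pow] at hsum
  have hJR := mul_le_mul_of_nonneg_left hR (Nat.cast_nonneg (α := ℝ) J.card)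
  have hNK : (0 : ℝ) < (N : ℝ) ^ K := by positivity
  have : (N : ℝ) ^ K * (C * F) ≤ (N : ℝ) ^ K * 1 := by
    rw [hC]; nlinarith
  exact absurd (le_of_mul_le_mul_left this hNK) (not_le.mpr hF1)

/-! ### Comparing the cut-set bound with `codedRate` -/

theorem codedRate_eq_zero_of_lt {M : ℝ} {N : ℕ} (K : ℕ) (h : (N : ℝ) < M) :
    codedRate M N K = 0 := by
  have hN : (0 : ℝ) ≤ N := Nat.cast_nonneg N
  rw [codedRate, if_neg (by linarith), if_neg (by linarith)]

/-- All that the converse needs for `M ≤ N`. For `M > 0` the bounds come from Bernoulli's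
inequality, from the second entry of the minimum, and from discarding the power in the first entry.
-/
theorem codedRate_bounds {M : ℝ} {N : ℕ} (K : ℕ) (hN : 0 < N) (hM : 0 ≤ M) (hMN : M ≤ N) :
    codedRate M N K ≤ K ∧ codedRate M N K ≤ N ∧ codedRate M N K * M ≤ N - M := by
  have hN' : (0 : ℝ) < N := by exact_mod_cast hN
  rw [codedRate]
  split_ifs with h0
  · subst h0
    exact ⟨min_le_right _ _, min_le_left _ _, by simp⟩
  have hM' : 0 < M := lt_of_le_of_ne hM (Ne.symm h0)
  rcases K.eq_zero_or_pos with rfl | hK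
  · simp [hMN]
  have hK' : (0 : ℝ) < K := by exact_mod_cast hK
  have hμ0 : 0 ≤ 1 - M / N := by rw [sub_nonneg, div_le_one hN']; exact hMN
  have hμ1 : 1 - M / N ≤ 1 := by have : 0 ≤ M / N := by positivity
                                 linarith
  have hbern : 1 - (1 - M / N) ^ K ≤ K * (M / N) := by
    have := one_add_mul_le_pow (a := -(M / N)) (by linarith) K
    rw [← sub_eq_add_neg] at this
    linarith
  have hpow : 0 ≤ (1 - M / N) ^ K := pow_nonneg hμ0 K
  have hpow1 : 0 ≤ 1 - (1 - M / N) ^ K := sub_nonneg.mpr (pow_le_one₀ hμ0 hμ1)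
  refine ⟨?_, ?_, ?_⟩
  · calc _ ≤ K * (1 - M / N) * (N / (K * M) * (1 - (1 - M / N) ^ K)) := by
          gcongr; exact min_le_left _ _
      _ ≤ K * 1 * (N / (K * M) * (K * (M / N))) := by gcongr
      _ = K := by field_simp
  · calc _ ≤ K * (1 - M / N) * ((N : ℝ) / K) := by
          gcongr; exact min_le_right _ _
      _ ≤ K * 1 * ((N : ℝ) / K) := by gcongr
      _ = N := by field_simp
  · calc _ ≤ K * (1 - M / N) * (N / (K * M) * (1 - (1 - M / N) ^ K)) * M := by
          gcongr; exact min_le_left _ _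
      _ ≤ K * (1 - M / N) * (N / (K * M) * 1) * M := by gcongr; linarith
      _ = N - M := by field_simp

/-- For large caches, `s = 1` and `b = N` give `N - M ≤ N R`, and `codedRate * M ≤ N - M` suffices.
For small caches the same cut forces `R > 11/12`, so a counterexample has `codedRate > 66`, which
leaves room for rounding `s` and `b`. -/
theorem codedRate_le_of_cutset {M R : ℝ} {N K : ℕ} (hN : 0 < N) (hM : 0 ≤ M)
    (h : ∀ s ≤ K, ∀ b ≤ N, N * (1 - (1 - (b : ℝ) / N) ^ s) ≤ s * M + b * R) :
    codedRate M N K ≤ 72 * R := by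
  have hN' : (0 : ℝ) < N := by exact_mod_cast hN
  have hR : 0 ≤ R := by
    have := h 0 (Nat.zero_le K) N le_rfl
    simp only [pow_zero, sub_self, mul_zero, Nat.cast_zero, zero_mul, zero_add] at this
    exact nonneg_of_mul_nonneg_right this hN'
  rcases lt_or_ge (N : ℝ) M with hMN | hMN
  · rw [codedRate_eq_zero_of_lt K hMN]; positivity
  obtain ⟨hcK, hcN, hcM⟩ := codedRate_bounds K hN hM hMN
  set c := codedRate M N K
  rcases K.eq_zero_or_pos with rfl | hK
  · refine hcK.trans ?_
    simpa using hR
  have h1 : N ≤ M + N * R := by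
    have := h 1 hK N le_rfl
    rwa [div_self hN'.ne', sub_self, zero_pow one_ne_zero, sub_zero, mul_one, Nat.cast_one,
      one_mul] at this
  rcases le_or_gt (N : ℝ) (12 * M) with h12 | h12
  · by_contra! hlt
    nlinarith
  by_contra! hlt
  have hR1 : 11 / 12 < R := by nlinarith
  have hc : 66 < c := by linarith
  -- Since `c * M ≤ N`, the caches of `s` users contribute at most `N / 6`; since `c ≤ K` and `c ≤
  -- N`, also `s ≤ K` and `s ≤ N / 6`.
  set s := ⌊c / 6⌋₊
  have hs1 : (s : ℝ) ≤ c / 6 := Nat.floor_le (by linarith)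
  have hs2 : c / 12 ≤ s := by have := Nat.lt_floor_add_one (c / 6); linarith
  have hs0 : (0 : ℝ) < s := by linarith
  have hsK : s ≤ K := by
    have : (s : ℝ) ≤ K := by linarith
    exact_mod_cast this
  -- Now `s * b ≥ N`, so the cut reveals at least `N (1 - 1/e) ≥ N / 2` files. The messages account
  -- for `N / 3` of this, so `s ≤ 6 R`, while `s ≥ c / 12`.
  set b := ⌈(N : ℝ) / s⌉₊
  have hb1 : (N : ℝ) / s ≤ b := Nat.le_ceil _
  have hbN : b ≤ N := Nat.ceil_le.mpr (div_le_self hN'.le (by linarith))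
  have hb2 : (b : ℝ) ≤ 2 * N / s := by
    have h2 : (b : ℝ) < N / s + 1 := Nat.ceil_lt_add_one (by positivity)
    have h3 : (1 : ℝ) ≤ N / s := by rw [le_div_iff₀ hs0]; linarith
    rw [mul_div_assoc]; linarith
  have hbN' : (b : ℝ) / N ≤ 1 := by rw [div_le_one hN']; exact_mod_cast hbN
  have hexp : (1 - (b : ℝ) / N) ^ s ≤ 1 / 2 := by
    calc (1 - (b : ℝ) / N) ^ s ≤ Real.exp (-(b / N)) ^ s := by
          exact pow_le_pow_left₀ (by linarith) (Real.one_sub_le_exp_neg _) s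
      _ = Real.exp (-(s * (b / N))) := by rw [← Real.exp_nat_mul]; ring_nf
      _ ≤ Real.exp (-1) := by
          gcongr
          rw [← mul_div_assoc, le_div_iff₀ hN', one_mul, mul_comm]
          rwa [div_le_iff₀ hs0] at hb1
      _ ≤ 1 / 2 := by
          rw [Real.exp_neg, one_div]
          gcongr
          linarith [Real.exp_one_gt_d9]
  have hcut := h s hsK b hbN
  have hsM : s * M ≤ N / 6 := by nlinarith
  have hbR : (b : ℝ) * R ≤ 2 * N / s * R := by gcongr
  have h3 : (N : ℝ) / 3 ≤ 2 * N / s * R := by nlinarith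
  rw [div_mul_eq_mul_div, le_div_iff₀ hs0] at h3
  have h4 : (s : ℝ) ≤ 6 * R := by
    have : (N : ℝ) * s ≤ N * (6 * R) := by linarith
    exact le_of_mul_le_mul_left this hN'
  linarith

theorem AchievableExpected.codedRate_le {N K : ℕ} {M R : ℝ} (hN : 0 < N) (hM : 0 ≤ M)
    (h : AchievableExpected M (fun _ : Fin N => (1 : ℝ) / N) K R) :
    codedRate M N K ≤ 72 * R := by
  have : NeZero N := ⟨hN.ne'⟩
  refine codedRate_le_of_cutset hN hM fun s hs b hb => ?_
  obtain ⟨U, -, hU⟩ := Finset.exists_subset_card_eq (s := (Finset.univ : Finset (Fin K)))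
    (n := s) (by simpa using hs)
  obtain ⟨J, -, hJ⟩ := Finset.exists_subset_card_eq (s := (Finset.univ : Finset (Fin N)))
    (n := b) (by simpa using hb)
  simpa [hU, hJ] using h.cutset U J

/-! ### The load of the first delivery procedure -/

/-- The expected load of the first delivery procedure per bit of a file, when every user caches each
bit with probability `q`. -/
noncomputable def xorRate (K : ℕ) (q : ℝ) : ℝ :=
  ∑ S : Finset (Fin K), if S = ∅ then 0 else q ^ (S.card - 1) * (1 - q) ^ (K - (S.card - 1))

/-- Needed because the cached fraction of a file only tends to `min (M / N) 1`. -/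
theorem continuous_xorRate (K : ℕ) : Continuous (xorRate K) := by
  unfold xorRate
  refine continuous_finsetSum _ fun S _ => ?_
  split_ifs <;> fun_prop

/-- Multiplication by `q` turns the term of each nonempty `S` into `1 - q` times its binomial
weight; the weights of all sets sum to `1`, and only the empty set is missing. -/
theorem mul_xorRate (K : ℕ) (q : ℝ) : q * xorRate K q = (1 - q) * (1 - (1 - q) ^ K) := by
  have h : ∀ S : Finset (Fin K),
      q * (if S = ∅ then 0 else q ^ (S.card - 1) * (1 - q) ^ (K - (S.card - 1))) =
        (1 - q) * (q ^ S.card * (1 - q) ^ (K - S.card)) -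
          if S = ∅ then (1 - q) * (1 - q) ^ K else 0 := by
    intro S
    split_ifs with hS
    · simp [hS]
    · have h1 : 0 < S.card := Finset.card_pos.mpr (Finset.nonempty_iff_ne_empty.mpr hS)
      have h2 : S.card ≤ K := by simpa using S.card_le_univ
      obtain ⟨a, ha⟩ : ∃ a, S.card = a + 1 := ⟨S.card - 1, by omega⟩
      have h3 : K - (S.card - 1) = K - S.card + 1 := by omega
      rw [h3, ha, Nat.add_sub_cancel]
      ring
  have h2 := Fintype.sum_pow_mul_eq_add_pow (Fin K) q (1 - q)
  rw [Fintype.card_fin, add_sub_cancel, one_pow] at h2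
  rw [xorRate, Finset.mul_sum, Finset.sum_congr rfl fun S _ => h S, Finset.sum_sub_distrib,
    ← Finset.mul_sum, h2, Finset.sum_ite_eq' Finset.univ ∅, if_pos (Finset.mem_univ _)]
  ring

/-- `mul_xorRate` is void at `q = 0`; here only singletons contribute, through `0 ^ 0 = 1`. -/
theorem xorRate_zero (K : ℕ) : xorRate K 0 = K := by
  have h : ∀ S : Finset (Fin K), (if S = ∅ then (0 : ℝ) else
      0 ^ (S.card - 1) * (1 - 0) ^ (K - (S.card - 1))) = if S.card = 1 then 1 else 0 := by
    intro S
    rcases Finset.eq_empty_or_nonempty S with rfl | hS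
    · simp
    · have h1 := Finset.card_pos.mpr hS
      rw [if_neg hS.ne_empty, sub_zero, one_pow, mul_one]
      split_ifs with h2
      · simp [h2]
      · exact zero_pow (by omega)
  rw [xorRate, Finset.sum_congr rfl fun S _ => h S, Finset.sum_boole]
  have : (Finset.univ.filter fun S : Finset (Fin K) => S.card = 1) =
      Finset.powersetCard 1 Finset.univ := by ext S; simp [Finset.mem_powersetCard]
  rw [this, Finset.card_powersetCard]
  simp

theorem xorRate_one (K : ℕ) : xorRate K 1 = 0 := by
  simpa using mul_xorRate K 1

theorem codedRate_eq_min {M : ℝ} {N : ℕ} (K : ℕ) (hN : 0 < N) (hM : 0 ≤ M) :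
    codedRate M N K = min (xorRate K (min (M / N) 1)) (N * (1 - min (M / N) 1)) := by
  have hN' : (0 : ℝ) < N := by exact_mod_cast hN
  rcases lt_or_ge (N : ℝ) M with hMN | hMN
  · rw [codedRate_eq_zero_of_lt K hMN, min_eq_right (a := M / N) (by rw [le_div_iff₀ hN']; linarith),
      xorRate_one]
    simp
  rw [min_eq_left (a := M / N) (by rwa [div_le_one hN']), codedRate]
  split_ifs with h0
  · simp [h0, xorRate_zero, min_comm]
  have hM' : 0 < M := lt_of_le_of_ne hM (Ne.symm h0)
  have hμ0 : 0 ≤ 1 - M / N := by rw [sub_nonneg, div_le_one hN']; exact hMN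
  have hx : xorRate K (M / N) = N / M * ((1 - M / N) * (1 - (1 - M / N) ^ K)) := by
    rw [← mul_xorRate]; field_simp
  rw [hx]
  rcases K.eq_zero_or_pos with rfl | hK
  · simp only [CharP.cast_eq_zero, zero_mul, pow_zero, sub_self, mul_zero]
    rw [min_eq_left (by positivity)]
  have hK' : (0 : ℝ) < K := by exact_mod_cast hK
  rw [mul_min_of_nonneg _ _ (by positivity)]
  congr 1 <;> field_simp

theorem codedRate_nonneg {M : ℝ} {N : ℕ} (K : ℕ) (hN : 0 < N) (hM : 0 ≤ M) :
    0 ≤ codedRate M N K := by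
  have hN' : (0 : ℝ) < N := by exact_mod_cast hN
  have h1 : 0 ≤ 1 - min (M / N) 1 := sub_nonneg.mpr (min_le_right _ _)
  have h0 : 0 ≤ min (M / N) 1 := by positivity
  rw [codedRate_eq_min K hN hM]
  refine le_min (Finset.sum_nonneg fun S _ => ?_) (by positivity)
  split_ifs <;> positivity

theorem codedRate_pos {M : ℝ} {N K : ℕ} (hK : 0 < K) (hM : 0 ≤ M) (hMN : M < N) :
    0 < codedRate M N K := by
  have hN' : (0 : ℝ) < N := hM.trans_lt hMN
  have hK' : (0 : ℝ) < K := by exact_mod_cast hK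
  rw [codedRate]
  split_ifs with h0 h1
  · exact lt_min hN' hK'
  · have hM' : 0 < M := lt_of_le_of_ne hM (Ne.symm h0)
    have hμ0 : 0 < 1 - M / N := by rw [sub_pos, div_lt_one hN']; exact hMN
    have hμ1 : (1 - M / N) ^ K < 1 := pow_lt_one₀ hμ0.le
      (by have : 0 < M / N := by positivity
          linarith) hK.ne'
    have : 0 < 1 - (1 - M / N) ^ K := sub_pos.mpr hμ1
    refine mul_pos (by positivity) (lt_min (by positivity) (by positivity))
  · exact absurd hMN.le h1

/-! ### Concentration of the number of exclusively cached bits -/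

/-- A Chebyshev inequality for events that are pairwise negatively correlated. -/
theorem uniformProb_card_filter_gt_le {Ω : Type} [Fintype Ω] [Nonempty Ω] {F : ℕ} (hF : 0 < F)
    (E : Ω → Fin F → Prop) [∀ ω, DecidablePred (E ω)] {μ δ : ℝ} (hδ : 0 < δ)
    (h1 : ∀ i, uniformProb Ω (fun ω => E ω i) = μ)
    (h2 : ∀ i j, i ≠ j → uniformProb Ω (fun ω => E ω i ∧ E ω j) ≤ μ ^ 2) :
    uniformProb Ω (fun ω => (μ + δ) * F < (Finset.univ.filter (E ω)).card) ≤
      1 / (δ ^ 2 * F) := by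
  classical
  have hF' : (0 : ℝ) < F := by exact_mod_cast hF
  have hΩ : (0 : ℝ) < Fintype.card Ω := by exact_mod_cast Fintype.card_pos
  set X : Ω → ℝ := fun ω => ((Finset.univ.filter (E ω)).card : ℝ) with hX
  have hsum : ∑ ω, X ω = Fintype.card Ω * (F * μ) := by
    rw [hX, sum_card_filter_eq]
    simp [h1]
  have hsq : ∑ ω, X ω ^ 2 ≤ Fintype.card Ω * (F ^ 2 * μ ^ 2 + F) := by
    have h3 : ∀ ω, X ω ^ 2 = (((Finset.univ : Finset (Fin F × Fin F)).filter
        fun x => E ω x.1 ∧ E ω x.2).card : ℝ) := by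
      intro ω
      rw [← Finset.univ_product_univ, Finset.filter_product, Finset.card_product, hX]
      push_cast
      ring
    simp only [h3]
    rw [sum_card_filter_eq Finset.univ fun ω (x : Fin F × Fin F) => E ω x.1 ∧ E ω x.2]
    gcongr
    rw [Fintype.sum_prod_type]
    -- Only the diagonal exceeds `μ ^ 2`, so the variance is at most `F`.
    calc _ ≤ ∑ i : Fin F, ∑ j : Fin F, (μ ^ 2 + if i = j then 1 else 0) := by
          refine Finset.sum_le_sum fun i _ => Finset.sum_le_sum fun j _ => ?_
          by_cases hij : i = j
          · rw [if_pos hij]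
            have h4 := uniformProb_mono (Ω := Ω) (E := fun ω => E ω i ∧ E ω j)
              (E' := fun _ => True) (fun _ _ => trivial)
            rw [uniformProb_true] at h4
            have := sq_nonneg μ
            linarith
          · rw [if_neg hij, add_zero]
            exact h2 i j hij
      _ = _ := by simp [Finset.sum_add_distrib]; ring
  have hvar : ∑ ω, (X ω - μ * F) ^ 2 ≤ Fintype.card Ω * F := by
    have h5 : ∀ ω, (X ω - μ * F) ^ 2 = X ω ^ 2 - 2 * μ * F * X ω + μ ^ 2 * F ^ 2 :=
      fun ω => by ring
    simp only [h5, Finset.sum_add_distrib, Finset.sum_sub_distrib, ← Finset.mul_sum, hsum,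
      Finset.sum_const, Finset.card_univ, nsmul_eq_mul]
    nlinarith
  have hδF : 0 < δ * F := mul_pos hδ hF'
  have hmarkov : (∑ ω, if (μ + δ) * F < X ω then (1 : ℝ) else 0) * (δ * F) ^ 2 ≤
      ∑ ω, (X ω - μ * F) ^ 2 := by
    rw [Finset.sum_mul]
    refine Finset.sum_le_sum fun ω _ => ?_
    split_ifs with h
    · rw [one_mul]
      exact pow_le_pow_left₀ hδF.le (by linarith) 2
    · rw [zero_mul]; positivity
  rw [uniformProb_eq_sum, div_le_div_iff₀ hΩ (by positivity), one_mul]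
  have h6 := hmarkov.trans hvar
  have h7 : (∑ ω, if (μ + δ) * F < X ω then (1 : ℝ) else 0) * (δ ^ 2 * F) * F ≤
      Fintype.card Ω * F := by
    calc _ = (∑ ω, if (μ + δ) * F < X ω then (1 : ℝ) else 0) * (δ * F) ^ 2 := by ring
      _ ≤ _ := h6
  convert le_of_mul_le_mul_right h7 hF'

/-! ### Uniformly random sets of fixed size and random placements -/

instance nonempty_subsets {F m : ℕ} [h : Fact (m ≤ F)] :
    Nonempty {C : Finset (Fin F) // C.card = m} := by
  obtain ⟨C, -, hC⟩ := Finset.exists_subset_card_eq (s := (Finset.univ : Finset (Fin F)))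
    (n := m) (by simpa using h.out)
  exact ⟨⟨C, hC⟩⟩

theorem uniformProb_disjoint {F m : ℕ} (A : Finset (Fin F)) :
    uniformProb {C : Finset (Fin F) // C.card = m} (fun C => ∀ i ∈ A, i ∉ C.1) =
      ((F - A.card).choose m : ℝ) / F.choose m := by
  classical
  rw [uniformProb]
  congr 1
  · let e : {C : {C : Finset (Fin F) // C.card = m} // ∀ i ∈ A, i ∉ C.1} ≃
        {C // C ∈ Finset.powersetCard m Aᶜ} :=
      { toFun := fun C => ⟨C.1.1, Finset.mem_powersetCard.mpr
          ⟨fun i hi => Finset.mem_compl.mpr fun hA => C.2 i hA hi, C.1.2⟩⟩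
        invFun := fun C => ⟨⟨C.1, (Finset.mem_powersetCard.mp C.2).2⟩, fun i hi hC =>
          Finset.mem_compl.mp ((Finset.mem_powersetCard.mp C.2).1 hC) hi⟩
        left_inv := fun _ => rfl
        right_inv := fun _ => rfl }
    rw [Nat.card_congr e, Nat.card_eq_fintype_card, Fintype.card_coe, Finset.card_powersetCard,
      Finset.card_compl, Fintype.card_fin]
  · rw [Fintype.card_finset_len, Fintype.card_fin]

section

variable {F m : ℕ} [hm : Fact (m ≤ F)]

theorem uniformProb_notMem (i : Fin F) :
    uniformProb {C : Finset (Fin F) // C.card = m} (fun C => i ∉ C.1) = 1 - (m : ℝ) / F := by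
  have h := uniformProb_disjoint (m := m) {i}
  simp only [Finset.mem_singleton, forall_eq, Finset.card_singleton] at h
  obtain ⟨n, rfl⟩ : ∃ n, F = n + 1 := ⟨F - 1, by have := i.isLt; omega⟩
  have hc : ((n + 1).choose m : ℝ) ≠ 0 := by exact_mod_cast (Nat.choose_pos hm.out).ne'
  have h1 : (n.choose m : ℝ) * (n + 1) = (n + 1).choose m * (n + 1 - m) := by
    have := Nat.choose_mul_succ_eq n m
    have h2 : ((n + 1 - m : ℕ) : ℝ) = n + 1 - m := by rw [Nat.cast_sub hm.out]; push_cast; ring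
    rw [← h2]
    exact_mod_cast this
  rw [h, Nat.add_sub_cancel]
  push_cast
  have hn : (n : ℝ) + 1 ≠ 0 := by positivity
  field_simp
  linarith

theorem uniformProb_mem (i : Fin F) :
    uniformProb {C : Finset (Fin F) // C.card = m} (fun C => i ∈ C.1) = m / F := by
  have h := uniformProb_not (Ω := {C : Finset (Fin F) // C.card = m}) (fun C => i ∈ C.1)
  rw [uniformProb_notMem] at h
  linarith

/-- Sampling without replacement: the probability is `(1 - m/F) (1 - m/(F-1))` for `m < F`, and zero
for `m = F`. -/
theorem uniformProb_notMem_and_notMem {i j : Fin F} (hij : i ≠ j) :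
    uniformProb {C : Finset (Fin F) // C.card = m} (fun C => i ∉ C.1 ∧ j ∉ C.1) ≤
      (1 - (m : ℝ) / F) ^ 2 := by
  have h := uniformProb_disjoint (m := m) {i, j}
  simp only [Finset.mem_insert, Finset.mem_singleton, forall_eq_or_imp, forall_eq,
    Finset.card_pair hij] at h
  obtain ⟨n, rfl⟩ : ∃ n, F = n + 2 := ⟨F - 2, by
    have := i.isLt; have := j.isLt; have : i.1 ≠ j.1 := fun h => hij (Fin.ext h); omega⟩
  rw [h, Nat.add_sub_cancel]
  have hc : (0 : ℝ) < (n + 2).choose m := by exact_mod_cast Nat.choose_pos hm.out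
  rcases (lt_or_eq_of_le hm.out) with hlt | heq
  · have h1 : (n.choose m : ℝ) * (n + 1) = (n + 1).choose m * (n + 1 - m) := by
      have := Nat.choose_mul_succ_eq n m
      have h2 : ((n + 1 - m : ℕ) : ℝ) = n + 1 - m := by
        rw [Nat.cast_sub (by omega)]; push_cast; ring
      rw [← h2]
      exact_mod_cast this
    have h3 : ((n + 1).choose m : ℝ) * (n + 2) = (n + 2).choose m * (n + 2 - m) := by
      have := Nat.choose_mul_succ_eq (n + 1) m
      have h2 : ((n + 1 + 1 - m : ℕ) : ℝ) = n + 2 - m := by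
        rw [Nat.cast_sub (by omega)]; push_cast; ring
      rw [← h2]
      exact_mod_cast this
    have hmn : (m : ℝ) ≤ n + 1 := by exact_mod_cast Nat.lt_succ_iff.mp hlt
    have h4 : (n.choose m : ℝ) / (n + 2).choose m =
        (1 - m / (n + 2)) * ((n + 1 - m) / (n + 1)) := by
      have h5 : (n.choose m : ℝ) * ((n + 1) * (n + 2)) =
          (n + 2).choose m * ((n + 2 - m) * (n + 1 - m)) := by
        linear_combination (n + 2 : ℝ) * h1 + (n + 1 - m : ℝ) * h3
      have hn1 : (n : ℝ) + 1 ≠ 0 := by positivity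
      have hn2 : (n : ℝ) + 2 ≠ 0 := by positivity
      field_simp
      linarith
    rw [h4]
    push_cast
    rw [sq]
    have h6 : (0 : ℝ) ≤ 1 - m / (n + 2) := by
      rw [sub_nonneg, div_le_one (by positivity)]; linarith
    refine mul_le_mul_of_nonneg_left ?_ h6
    rw [div_le_iff₀ (by positivity), sub_mul, div_mul_eq_mul_div, le_sub_comm,
      div_le_iff₀ (by positivity)]
    have : (0 : ℝ) ≤ m := Nat.cast_nonneg m
    nlinarith
  · rw [Nat.choose_eq_zero_of_lt (by omega), Nat.cast_zero, zero_div]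
    positivity

/-- By inclusion-exclusion, complementing both events leaves their covariance unchanged. -/
theorem uniformProb_mem_and_mem {i j : Fin F} (hij : i ≠ j) :
    uniformProb {C : Finset (Fin F) // C.card = m} (fun C => i ∈ C.1 ∧ j ∈ C.1) ≤
      ((m : ℝ) / F) ^ 2 := by
  classical
  have h : uniformProb {C : Finset (Fin F) // C.card = m} (fun C => i ∈ C.1 ∧ j ∈ C.1) + 1 =
      uniformProb {C : Finset (Fin F) // C.card = m} (fun C => i ∈ C.1) +
      uniformProb {C : Finset (Fin F) // C.card = m} (fun C => j ∈ C.1) +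
      uniformProb {C : Finset (Fin F) // C.card = m} (fun C => i ∉ C.1 ∧ j ∉ C.1) := by
    rw [← uniformProb_true {C : Finset (Fin F) // C.card = m}]
    simp only [uniformProb_eq_sum]
    rw [← add_div, ← add_div, ← add_div, ← Finset.sum_add_distrib, ← Finset.sum_add_distrib,
      ← Finset.sum_add_distrib]
    congr 1
    refine Finset.sum_congr rfl fun C _ => ?_
    by_cases hi : i ∈ C.1 <;> by_cases hj : j ∈ C.1 <;> simp [hi, hj]
  have h1 := uniformProb_notMem_and_notMem (m := m) hij
  rw [uniformProb_mem, uniformProb_mem] at h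
  nlinarith

variable {N K : ℕ}

theorem uniformProb_placement (n : Fin N)
    (Q : Fin K → {C : Finset (Fin F) // C.card = m} → Prop) :
    uniformProb (Placement N K F m) (fun P => ∀ j, Q j (P j n)) =
      ∏ j, uniformProb {C : Finset (Fin F) // C.card = m} (Q j) := by
  rw [uniformProb_pi (α := fun _ : Fin K => Fin N → {C : Finset (Fin F) // C.card = m})
    fun j f => Q j (f n)]
  exact Finset.prod_congr rfl fun j _ => uniformProb_apply n (Q j)

theorem prod_ite_mem_eq (S : Finset (Fin K)) (x y : ℝ) :
    ∏ j, (if j ∈ S then x else y) = x ^ S.card * y ^ (K - S.card) := by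
  rw [Finset.prod_ite, Finset.prod_const, Finset.prod_const, Finset.filter_mem_eq_inter,
    Finset.univ_inter, Finset.filter_not, Finset.filter_mem_eq_inter, Finset.univ_inter,
    Finset.card_univ_sdiff, Fintype.card_fin]

theorem uniformProb_exclusive (n : Fin N) (S : Finset (Fin K)) (i : Fin F) :
    uniformProb (Placement N K F m) (fun P => ∀ j, i ∈ (P j n).1 ↔ j ∈ S) =
      ((m : ℝ) / F) ^ S.card * (1 - (m : ℝ) / F) ^ (K - S.card) := by
  rw [uniformProb_placement n fun j C => i ∈ C.1 ↔ j ∈ S, ← prod_ite_mem_eq]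
  refine Finset.prod_congr rfl fun j _ => ?_
  by_cases hj : j ∈ S
  · simpa [hj] using uniformProb_mem i
  · simpa [hj] using uniformProb_notMem i

/-- Each user must cache both bits or neither. Both kinds of event are negatively correlated, and
the users are independent. -/
theorem uniformProb_exclusive_and (n : Fin N) (S : Finset (Fin K)) {i i' : Fin F}
    (hi : i ≠ i') :
    uniformProb (Placement N K F m) (fun P => (∀ j, i ∈ (P j n).1 ↔ j ∈ S) ∧
        ∀ j, i' ∈ (P j n).1 ↔ j ∈ S) ≤
      (((m : ℝ) / F) ^ S.card * (1 - (m : ℝ) / F) ^ (K - S.card)) ^ 2 := by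
  simp only [← forall_and]
  rw [uniformProb_placement n fun j C => (i ∈ C.1 ↔ j ∈ S) ∧ (i' ∈ C.1 ↔ j ∈ S), mul_pow,
    ← pow_mul, ← pow_mul, mul_comm S.card, mul_comm (K - S.card), pow_mul, pow_mul,
    ← prod_ite_mem_eq]
  refine Finset.prod_le_prod (fun _ _ => uniformProb_nonneg _ _) fun j _ => ?_
  by_cases hj : j ∈ S
  · simpa [hj] using uniformProb_mem_and_mem hi
  · simpa [hj] using uniformProb_notMem_and_notMem hi

/-- For some file and some set of users, many more bits than expected are cached exactly by these
users. -/
def Atypical (δ : ℝ) (P : Placement N K F m) : Prop :=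
  ∃ x ∈ (Finset.univ : Finset (Fin N × Finset (Fin K))),
    (((m : ℝ) / F) ^ x.2.card * (1 - (m : ℝ) / F) ^ (K - x.2.card) + δ) * F <
      ((Finset.univ.filter fun i => ∀ j, i ∈ (P j x.1).1 ↔ j ∈ x.2).card : ℝ)

theorem uniformProb_atypical_le (hF : 0 < F) {δ : ℝ} (hδ : 0 < δ) :
    uniformProb (Placement N K F m) (Atypical δ) ≤ N * 2 ^ K * (1 / (δ ^ 2 * F)) := by
  have h : ∀ x : Fin N × Finset (Fin K), uniformProb (Placement N K F m) (fun P =>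
      (((m : ℝ) / F) ^ x.2.card * (1 - (m : ℝ) / F) ^ (K - x.2.card) + δ) * F <
        ((Finset.univ.filter fun i => ∀ j, i ∈ (P j x.1).1 ↔ j ∈ x.2).card : ℝ)) ≤
      1 / (δ ^ 2 * F) := fun x =>
    uniformProb_card_filter_gt_le hF (fun (P : Placement N K F m) i =>
      ∀ j, i ∈ (P j x.1).1 ↔ j ∈ x.2) hδ (uniformProb_exclusive x.1 x.2)
      fun _ _ => uniformProb_exclusive_and x.1 x.2
  refine (uniformProb_exists_le Finset.univ _).trans ((Finset.sum_le_sum fun x _ => h x).trans_eq ?_)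
  rw [Finset.sum_const, nsmul_eq_mul]
  simp

end

theorem card_xorIdx_le {N K F m : ℕ} {δ : ℝ} (hδ : 0 ≤ δ) {P : Placement N K F m} (hP : ¬ Atypical δ P)
    (d : Demand N K) :
    (Fintype.card (XorIdx P d) : ℝ) ≤ (xorRate K ((m : ℝ) / F) + 2 ^ K * δ) * F := by
  rw [Fintype.card_sigma]
  simp only [Fintype.card_fin]
  push_cast
  have h1 : ∀ S : Finset (Fin K), (xorLength P d S : ℝ) ≤
      ((if S = ∅ then 0 else ((m : ℝ) / F) ^ (S.card - 1) *
        (1 - (m : ℝ) / F) ^ (K - (S.card - 1))) + δ) * F := by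
    intro S
    rcases Finset.eq_empty_or_nonempty S with rfl | hS
    · simp only [xorLength, Finset.sup_empty, if_true]
      simp only [bot_eq_zero, Nat.cast_zero]
      positivity
    -- The length of the XOR is attained at some `k`, and typicality applies to the file `d k` and
    -- the set `S.erase k`.
    · obtain ⟨k, hk, hk'⟩ := Finset.exists_mem_eq_sup S hS
        fun k => (exclusiveBits P d k (S.erase k)).card
      rw [xorLength, hk', if_neg hS.ne_empty, ← Finset.card_erase_of_mem hk]
      by_contra! hlt
      exact hP ⟨(d k, S.erase k), Finset.mem_univ _, hlt⟩
  refine (Finset.sum_le_sum fun S _ => h1 S).trans_eq ?_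
  rw [← Finset.sum_mul, Finset.sum_add_distrib, xorRate]
  simp

/-! ### Decoding -/

/-- The decoder picks any library consistent with the message and the cache. -/
theorem Scheme.decodable_of_injective {N K F : ℕ} (s : Scheme N K F)
    (h : ∀ d k W W', s.msg d W = s.msg d W' → s.cache k W = s.cache k W' →
      W (d k) = W' (d k)) : s.Decodable := by
  classical
  refine ⟨fun d k a b => if hW : ∃ W, s.msg d W = a ∧ s.cache k W = b then hW.choose (d k) else 0,
    fun d W k => ?_⟩
  have hW : ∃ W', s.msg d W' = s.msg d W ∧ s.cache k W' = s.cache k W := ⟨W, rfl, rfl⟩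
  dsimp only
  rw [dif_pos hW]
  exact h d k _ _ hW.choose_spec.1 hW.choose_spec.2

section

variable {N K F m T : ℕ}

/-- For a bit that user `k` lacks, let `S'` be the set of users caching it. In the XOR for `insert k
S'`, every other summand consists of bits cached at user `k`, so it cancels. -/
theorem eq_of_xorMsg_eq (P : Placement N K F m) (d : Demand N K) (k : Fin K) {W W' : Library N F}
    (hc : ∀ n, ∀ i ∈ (P k n).1, W n i = W' n i) (hx : ∀ x, xorMsg P d W x = xorMsg P d W' x) :
    W (d k) = W' (d k) := by
  classical
  funext i
  by_cases hi : i ∈ (P k (d k)).1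
  · exact hc _ i hi
  set S' : Finset (Fin K) := Finset.univ.filter fun j => i ∈ (P j (d k)).1 with hS'
  have hk : k ∉ S' := by simpa [hS'] using hi
  have hmem : i ∈ exclusiveBits P d k S' := by simp [exclusiveBits, hS']
  obtain ⟨j, hj⟩ : ∃ j, (exclusiveBits P d k S').orderEmbOfFin rfl j = i := by
    have := Finset.range_orderEmbOfFin (exclusiveBits P d k S') rfl
    rw [← Finset.mem_coe, ← this] at hmem
    exact hmem
  have hlen : j.1 < xorLength P d (insert k S') := by
    refine j.2.trans_le ?_
    have := Finset.le_sup (f := fun k' => (exclusiveBits P d k' ((insert k S').erase k')).card)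
      (Finset.mem_insert_self k S')
    rwa [Finset.erase_insert hk] at this
  have hxor := hx ⟨insert k S', ⟨j.1, hlen⟩⟩
  simp only [xorMsg] at hxor
  rw [Finset.sum_insert hk, Finset.sum_insert hk, Finset.erase_insert hk] at hxor
  have hothers : ∀ k' ∈ S', subfile P d W k' ((insert k S').erase k') j.1 =
      subfile P d W' k' ((insert k S').erase k') j.1 := by
    intro k' hk'
    unfold subfile
    split_ifs with h
    · refine hc _ _ ?_
      have h1 := Finset.orderEmbOfFin_mem (exclusiveBits P d k' ((insert k S').erase k')) rfl
        ⟨j.1, h⟩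
      exact ((Finset.mem_filter.mp h1).2 k).mpr (Finset.mem_erase.mpr
        ⟨fun h => hk (h ▸ hk'), Finset.mem_insert_self k S'⟩)
    · rfl
  rw [Finset.sum_congr rfl hothers] at hxor
  have h2 := add_right_cancel hxor
  simpa only [subfile, j.2, dif_pos, Fin.eta, hj] using h2

/-- Some nonzero vector supported on the bits of some file that some user has not cached is
annihilated by the coefficients. -/
def Degenerate (P : Placement N K F m) (A : Coeffs N F T) : Prop :=
  ∃ x ∈ (Finset.univ : Finset (Fin N × Fin K)),
    ∃ v ∈ (Finset.univ : Finset (Fin F → Bit)).filter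
      (fun v => v ≠ 0 ∧ ∀ i ∈ (P x.2 x.1).1, v i = 0),
    ∀ t, ∑ i, A x.1 t i * v i = 0

/-- If linear combinations are sent, two confusable versions of the requested file would differ by a
nonzero vector that vanishes on the cached bits and is annihilated by the coefficients. -/
theorem codedScheme_decodable {P : Placement N K F m} {A : Coeffs N F T}
    (h : ¬ Degenerate P A) : (codedScheme P A).Decodable := by
  refine Scheme.decodable_of_injective _ fun d k W W' hm hc => ?_
  have hc' : ∀ n, ∀ i ∈ (P k n).1, W n i = W' n i := fun n i hi => congrFun hc ⟨n, i, hi⟩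
  by_cases hU : UseXor P d T
  · exact eq_of_xorMsg_eq P d k hc' fun x => congrFun hm (Sum.inl ⟨x, hU⟩)
  · by_contra hne
    refine h ⟨(d k, k), Finset.mem_univ _, W (d k) - W' (d k), ?_, fun t => ?_⟩
    · simp only [Finset.mem_filter, Finset.mem_univ, true_and, Pi.sub_apply]
      exact ⟨sub_ne_zero.mpr hne, fun i hi => sub_eq_zero.mpr (hc' _ i hi)⟩
    · have := congrFun hm (Sum.inr ⟨(⟨d k, k, rfl⟩, t), hU⟩)
      change linMsg A d W _ = linMsg A d W' _ at this
      simp only [linMsg] at this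
      simp only [Pi.sub_apply, mul_sub, Finset.sum_sub_distrib, this, sub_self]

theorem uniformProb_comp_equiv {Ω : Type} [Fintype Ω] (e : Ω ≃ Ω) (E : Ω → Prop) :
    uniformProb Ω (fun ω => E (e ω)) = uniformProb Ω E := by
  unfold uniformProb
  rw [Nat.card_congr (e.subtypeEquiv fun _ => Iff.rfl)]

/-- Flipping a coordinate of `a` at which `v` is nonzero changes the dot product. -/
theorem uniformProb_dotProduct_eq_zero_le {v : Fin F → Bit} (hv : v ≠ 0) :
    uniformProb (Fin F → Bit) (fun a => ∑ i, a i * v i = 0) ≤ 1 / 2 := by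
  classical
  obtain ⟨i, hi⟩ := Function.ne_iff.mp hv
  have h1 := uniformProb_comp_equiv (Equiv.addRight (Pi.single i (1 : Bit)))
    fun a : Fin F → Bit => ∑ i, a i * v i = 0
  have h2 := uniformProb_not fun a : Fin F → Bit => ∑ i, a i * v i = 0
  have h3 : uniformProb (Fin F → Bit)
      (fun a => ∑ j, (Equiv.addRight (Pi.single i (1 : Bit)) a) j * v j = 0) ≤
      uniformProb (Fin F → Bit) (fun a => ¬ ∑ i, a i * v i = 0) := by
    refine uniformProb_mono fun a ha h0 => hi ?_
    simpa [add_mul, Finset.sum_add_distrib, h0, Pi.single_apply] using ha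
  linarith

theorem uniformProb_coeffs_le (n : Fin N) {v : Fin F → Bit} (hv : v ≠ 0) :
    uniformProb (Coeffs N F T) (fun A => ∀ t, ∑ i, A n t i * v i = 0) ≤ (1 / 2) ^ T := by
  rw [uniformProb_apply n fun B : Fin T → Fin F → Bit => ∀ t, ∑ i, B t i * v i = 0,
    uniformProb_pi fun (_ : Fin T) (a : Fin F → Bit) => ∑ i, a i * v i = 0]
  refine (Finset.prod_le_prod (fun _ _ => uniformProb_nonneg _ _)
    fun _ _ => uniformProb_dotProduct_eq_zero_le hv).trans_eq ?_
  simp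

theorem card_supported_le (C : Finset (Fin F)) :
    ((Finset.univ : Finset (Fin F → Bit)).filter
      (fun v => v ≠ 0 ∧ ∀ i ∈ C, v i = 0)).card ≤ 2 ^ (F - C.card) := by
  rw [← Fintype.card_coe]
  refine (Fintype.card_le_of_injective
    (β := {i // i ∉ C} → Bit) (fun v i => v.1 i.1) fun v w h => ?_).trans_eq ?_
  · apply Subtype.ext
    funext i
    by_cases hi : i ∈ C
    · rw [(Finset.mem_filter.mp v.2).2.2 i hi, (Finset.mem_filter.mp w.2).2.2 i hi]
    · exact congrFun h ⟨i, hi⟩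
  · simp

/-- For each file and user there are at most `2 ^ (F - m)` bad vectors, each annihilated with
probability at most `2 ^ (-(F - m + t))`; the `t` spare combinations make the union bound small. -/
theorem uniformProb_degenerate_le (P : Placement N K F m) (t : ℕ) :
    uniformProb (Coeffs N F (F - m + t)) (Degenerate P) ≤ N * K * (1 / 2) ^ t := by
  have h : ∀ x : Fin N × Fin K, uniformProb (Coeffs N F (F - m + t)) (fun A =>
      ∃ v ∈ (Finset.univ : Finset (Fin F → Bit)).filter
        (fun v => v ≠ 0 ∧ ∀ i ∈ (P x.2 x.1).1, v i = 0),
      ∀ t, ∑ i, A x.1 t i * v i = 0) ≤ (1 / 2) ^ t := by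
    intro x
    refine (uniformProb_exists_le _ _).trans ?_
    refine (Finset.sum_le_card_nsmul _ _ _ fun v hv =>
      uniformProb_coeffs_le x.1 (Finset.mem_filter.mp hv).2.1).trans ?_
    have h1 := card_supported_le (P x.2 x.1).1
    rw [(P x.2 x.1).2] at h1
    have h2 : ((((Finset.univ : Finset (Fin F → Bit)).filter
      (fun v => v ≠ 0 ∧ ∀ i ∈ (P x.2 x.1).1, v i = 0)).card : ℕ) : ℝ) ≤ 2 ^ (F - m) := by
      exact_mod_cast h1
    rw [nsmul_eq_mul, pow_add, ← mul_assoc]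
    calc _ ≤ 2 ^ (F - m) * (1 / 2 : ℝ) ^ (F - m) * (1 / 2) ^ t := by gcongr
      _ = (1 / 2) ^ t := by rw [← mul_pow]; norm_num
  refine (uniformProb_exists_le Finset.univ _).trans
    ((Finset.sum_le_sum fun x _ => h x).trans_eq ?_)
  rw [Finset.sum_const, nsmul_eq_mul]
  simp

/-! ### The load of the coded caching scheme -/

theorem codedScheme_load_le (P : Placement N K F m) (A : Coeffs N F T) (d : Demand N K) :
    (codedScheme P A).load d ≤ Fintype.card (XorIdx P d) ∧
      (codedScheme P A).load d ≤ N * T := by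
  have hlin : Fintype.card (LinIdx d T) ≤ N * T := by
    rw [Fintype.card_prod, Fintype.card_fin]
    exact Nat.mul_le_mul_right T ((Fintype.card_subtype_le _).trans_eq (Fintype.card_fin N))
  have hload : (codedScheme P A).load d = Fintype.card {_x : XorIdx P d // UseXor P d T} +
      Fintype.card {_x : LinIdx d T // ¬ UseXor P d T} := Fintype.card_sum
  by_cases hU : UseXor P d T
  · have : IsEmpty {_x : LinIdx d T // ¬ UseXor P d T} := ⟨fun x => x.2 hU⟩
    have h1 := Fintype.card_subtype_le fun _x : XorIdx P d => UseXor P d T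
    rw [Fintype.card_eq_zero (α := {_x : LinIdx d T // ¬ UseXor P d T}), add_zero] at hload
    have h2 : Fintype.card (XorIdx P d) ≤ Fintype.card (LinIdx d T) := hU
    omega
  · have : IsEmpty {_x : XorIdx P d // UseXor P d T} := ⟨fun x => hU x.2⟩
    have h1 := Fintype.card_subtype_le fun _x : LinIdx d T => ¬ UseXor P d T
    rw [Fintype.card_eq_zero (α := {_x : XorIdx P d // UseXor P d T}), zero_add] at hload
    have h2 : ¬ Fintype.card (XorIdx P d) ≤ Fintype.card (LinIdx d T) := hU
    omega

/-- An exact zero is needed where `codedRate` vanishes, since no additive error can be absorbed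
there. If all bits are cached, none is missing at user `k`. -/
theorem codedScheme_load_eq_zero (P : Placement N K F m) (A : Coeffs N F T) (d : Demand N K)
    (h : K = 0 ∨ m = F) : (codedScheme P A).load d = 0 := by
  refine Nat.le_zero.mp ((codedScheme_load_le P A d).1.trans (le_of_eq ?_))
  rw [Fintype.card_sigma]
  refine Finset.sum_eq_zero fun S _ => ?_
  rw [Fintype.card_fin, xorLength, ← Nat.bot_eq_zero, Finset.sup_eq_bot_iff]
  intro k _
  rw [Nat.bot_eq_zero, Finset.card_eq_zero, exclusiveBits, Finset.filter_eq_empty_iff]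
  intro i _ hi
  rcases h with rfl | rfl
  · exact k.elim0
  · have hu : (P k (d k)).1 = Finset.univ := by
      rw [← Finset.card_eq_iff_eq_univ, (P k (d k)).2, Fintype.card_fin]
    have := (hi k).mp (hu ▸ Finset.mem_univ i)
    simp at this

theorem cachedBits_le (M : ℝ) (N F : ℕ) : cachedBits M N F ≤ F := min_le_right _ _

theorem codedScheme_fitsMemory {M : ℝ} (hM : 0 ≤ M) (hN : 0 < N)
    (P : Placement N K F (cachedBits M N F)) (A : Coeffs N F T) :
    (codedScheme P A).FitsMemory M := by
  intro k
  have hN' : (0 : ℝ) < N := by exact_mod_cast hN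
  have h1 : Fintype.card ((codedScheme P A).CacheIdx k) = N * cachedBits M N F := by
    refine (Fintype.card_sigma (α := fun n => {i : Fin F // i ∈ (P k n).1})).trans ?_
    simp [(P k _).2]
  have h2 : (cachedBits M N F : ℝ) ≤ M * F / N :=
    (Nat.cast_le.mpr (min_le_left _ _)).trans (Nat.floor_le (by positivity))
  rw [h1]
  push_cast
  rwa [le_div_iff₀' hN'] at h2

end

theorem tendsto_cachedBits_div {M : ℝ} (hM : 0 ≤ M) (N : ℕ) :
    Filter.Tendsto (fun F : ℕ => (cachedBits M N F : ℝ) / F) Filter.atTop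
      (nhds (min (M / N) 1)) := by
  have h1 := (tendsto_nat_floor_mul_div_atTop (a := M / N) (by positivity)).comp
    (tendsto_natCast_atTop_atTop (R := ℝ))
  refine (h1.min (tendsto_const_nhds (x := (1 : ℝ)))).congr' ?_
  filter_upwards [Filter.eventually_gt_atTop 0] with F hF
  have hF' : (0 : ℝ) < F := by exact_mod_cast hF
  rw [cachedBits, Nat.cast_min, ← min_div_div_right hF'.le, div_self hF'.ne', Function.comp_apply,
    div_mul_eq_mul_div]

theorem codedScheme_eventually {N : ℕ} (K : ℕ) {M : ℝ} (hN : 0 < N) (hM : 0 ≤ M) {ε : ℝ}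
    (hε : 0 < ε) : ∀ᶠ F : ℕ in Filter.atTop, ∃ T : ℕ, 1 - ε ≤
      uniformProb (Placement N K F (cachedBits M N F) × Coeffs N F T) (fun ω =>
        (codedScheme ω.1 ω.2).FitsMemory M ∧ (codedScheme ω.1 ω.2).Decodable ∧
        ∀ d, ((codedScheme ω.1 ω.2).load d : ℝ) ≤ (codedRate M N K + ε) * F) := by
  set μ := min (M / N) 1 with hμ
  -- `t` does not depend on `F`, so the spare combinations cost a vanishing rate.
  obtain ⟨t, ht⟩ : ∃ t : ℕ, (N * K : ℝ) * (1 / 2) ^ t < ε / 2 := by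
    have := ((tendsto_pow_atTop_nhds_zero_of_lt_one (r := (1 / 2 : ℝ)) (by norm_num)
      (by norm_num)).const_mul (N * K : ℝ)).eventually_lt_const
      (show (N * K : ℝ) * 0 < ε / 2 by rw [mul_zero]; positivity)
    exact this.exists
  -- Summed over the `2 ^ K` sets of users, the deviations add up to `ε / 2`.
  set δ : ℝ := ε / (2 * 2 ^ K) with hδ
  have hδ0 : 0 < δ := by positivity
  have hq := tendsto_cachedBits_div hM N
  have hinv : Filter.Tendsto (fun F : ℕ => (1 : ℝ) / F) Filter.atTop (nhds 0) :=
    tendsto_const_div_atTop_nhds_zero_nat 1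
  have e1 := (((continuous_xorRate K).tendsto μ).comp hq).eventually_lt_const
    (show xorRate K μ < xorRate K μ + ε / 2 by linarith)
  have e2 := (((tendsto_const_nhds (x := (1 : ℝ))).sub hq).const_mul (N : ℝ)).add
    (hinv.const_mul (N * t : ℝ)) |>.eventually_lt_const
    (show N * (1 - μ) + N * t * 0 < N * (1 - μ) + ε by rw [mul_zero]; linarith)
  have e3 := (hinv.const_mul (N * 2 ^ K / δ ^ 2 : ℝ)).eventually_lt_const
    (show (N * 2 ^ K / δ ^ 2 : ℝ) * 0 < ε / 2 by rw [mul_zero]; positivity)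
  filter_upwards [e1, e2, e3, Filter.eventually_gt_atTop 0] with F h1 h2 h3 hF
  have hF' : (0 : ℝ) < F := by exact_mod_cast hF
  have hm : Fact (cachedBits M N F ≤ F) := ⟨cachedBits_le M N F⟩
  refine ⟨F - cachedBits M N F + t, ?_⟩
  have hA := uniformProb_atypical_le (N := N) (K := K) (m := cachedBits M N F) hF hδ0
  have hA' : uniformProb (Placement N K F (cachedBits M N F)) (Atypical δ) ≤ ε / 2 := by
    refine hA.trans (le_trans (le_of_eq ?_) h3.le)
    field_simp
  have hB : ∀ P : Placement N K F (cachedBits M N F),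
      uniformProb (Coeffs N F (F - cachedBits M N F + t)) (Degenerate P) ≤ ε / 2 :=
    fun P => (uniformProb_degenerate_le P t).trans ht.le
  have key := uniformProb_prod_ge (E := fun ω =>
        (codedScheme ω.1 ω.2).FitsMemory M ∧ (codedScheme ω.1 ω.2).Decodable ∧
        ∀ d, ((codedScheme ω.1 ω.2).load d : ℝ) ≤ (codedRate M N K + ε) * F) hA' hB ?_
  · rwa [add_halves] at key
  intro P A hP hA
  refine ⟨codedScheme_fitsMemory hM hN P A, codedScheme_decodable hA, fun d => ?_⟩
  obtain ⟨hl1, hl2⟩ := codedScheme_load_le P A d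
  rw [codedRate_eq_min K hN hM, ← hμ, ← min_add_add_right, min_mul_of_nonneg _ _ hF'.le]
  refine le_min ?_ ?_
  · refine (Nat.cast_le.mpr hl1).trans ((card_xorIdx_le hδ0.le hP d).trans ?_)
    have : (2 : ℝ) ^ K * δ = ε / 2 := by rw [hδ]; field_simp
    rw [this]
    rw [Function.comp_apply] at h1
    exact mul_le_mul_of_nonneg_right (by linarith) hF'.le
  · refine (Nat.cast_le.mpr hl2).trans ?_
    have h4 := mul_le_mul_of_nonneg_right h2.le hF'.le
    refine le_trans (le_of_eq ?_) h4
    push_cast [Nat.cast_sub (cachedBits_le M N F)]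
    field_simp

/-! ### Optimal rates -/

theorem exists_of_uniformProb_pos {Ω : Type} [Fintype Ω] {E : Ω → Prop}
    (h : 0 < uniformProb Ω E) : ∃ ω, E ω := by
  by_contra! hE
  have : IsEmpty {ω // E ω} := ⟨fun ω => hE ω.1 ω.2⟩
  simp [uniformProb] at h

theorem achievablePeak_codedRate_add {N : ℕ} (K : ℕ) {M : ℝ} (hN : 0 < N) (hM : 0 ≤ M) {δ : ℝ}
    (hδ : 0 < δ) : AchievablePeak M N K (codedRate M N K + δ) := by
  intro ε hε
  -- The cap `1 / 2` keeps the success probability positive for large `δ`, so a good deterministic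
  -- scheme exists.
  filter_upwards [codedScheme_eventually K hN hM (ε := min δ (1 / 2)) (by positivity)]
    with F ⟨T, hT⟩
  have hmin : min δ (1 / 2) ≤ 1 / 2 := min_le_right _ _
  obtain ⟨ω, hfit, ⟨D, hD⟩, hload⟩ := exists_of_uniformProb_pos (lt_of_lt_of_le (by linarith) hT)
  refine ⟨codedScheme ω.1 ω.2, D, hfit, fun d => (hload d).trans ?_, fun d => ?_⟩
  · gcongr
    exact min_le_left _ _
  · have : (codedScheme ω.1 ω.2).errorProb D d = 0 := by
      simp [Scheme.errorProb, uniformProb, hD]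
    rw [this]
    exact hε.le

theorem Scheme.expectedLoad_le {N K F : ℕ} (hN : 0 < N) (s : Scheme N K F) {B : ℝ}
    (h : ∀ d, (s.load d : ℝ) ≤ B) : s.expectedLoad (fun _ => (1 : ℝ) / N) ≤ B := by
  have hN' : (0 : ℝ) < N := by exact_mod_cast hN
  rw [expectedLoad_uniform, div_le_iff₀ (by positivity)]
  refine (Finset.sum_le_card_nsmul _ _ B fun d _ => h d).trans_eq ?_
  simp [mul_comm]

theorem AchievablePeak.achievableExpected {N K : ℕ} {M R : ℝ} (hN : 0 < N)
    (h : AchievablePeak M N K R) : AchievableExpected M (fun _ : Fin N => (1 : ℝ) / N) K R := by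
  intro ε hε
  filter_upwards [h ε hε] with F ⟨s, D, hM, hR, hD⟩
  exact ⟨s, D, hM, s.expectedLoad_le hN hR, hD⟩

theorem optRates_bounds {N : ℕ} (K : ℕ) {M : ℝ} (hN : 0 < N) (hM : 0 ≤ M) :
    codedRate M N K / 72 ≤ optExpectedRate M (fun _ : Fin N => (1 : ℝ) / N) K ∧
      optExpectedRate M (fun _ : Fin N => (1 : ℝ) / N) K ≤ optPeakRate M N K ∧
      optPeakRate M N K ≤ codedRate M N K := by
  have hlow : ∀ R, AchievableExpected M (fun _ : Fin N => (1 : ℝ) / N) K R →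
      codedRate M N K / 72 ≤ R := fun R hR => by
    have := hR.codedRate_le hN hM
    linarith
  have hpeak : ∀ δ : ℝ, 0 < δ → AchievablePeak M N K (codedRate M N K + δ) :=
    fun δ hδ => achievablePeak_codedRate_add K hN hM hδ
  have hne : {R | AchievablePeak M N K R}.Nonempty := ⟨_, hpeak 1 one_pos⟩
  have hsub : {R | AchievablePeak M N K R} ⊆
      {R | AchievableExpected M (fun _ : Fin N => (1 : ℝ) / N) K R} :=
    fun R hR => hR.achievableExpected hN
  have hbdd : BddBelow {R | AchievableExpected M (fun _ : Fin N => (1 : ℝ) / N) K R} :=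
    ⟨_, fun R hR => hlow R hR⟩
  exact ⟨le_csInf (hne.mono hsub) hlow, csInf_le_csInf hbdd hne hsub,
    le_of_forall_pos_le_add fun δ hδ => csInf_le (hbdd.mono hsub) (hpeak δ hδ)⟩

/-- Where `codedRate` is positive, an additive error of at most `codedRate` gives the factor `2`; in
the remaining cases nothing is sent. -/
theorem codedScheme_eventually_expectedLoad {N : ℕ} (K : ℕ) {M : ℝ} (hN : 0 < N) (hM : 0 ≤ M)
    {ε : ℝ} (hε : 0 < ε) : ∀ᶠ F : ℕ in Filter.atTop, ∃ T : ℕ, 1 - ε ≤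
      uniformProb (Placement N K F (cachedBits M N F) × Coeffs N F T) (fun ω =>
        (codedScheme ω.1 ω.2).FitsMemory M ∧ (codedScheme ω.1 ω.2).Decodable ∧
        (∀ d, ((codedScheme ω.1 ω.2).load d : ℝ) ≤ (codedRate M N K + ε) * F) ∧
        (codedScheme ω.1 ω.2).expectedLoad (fun _ => (1 : ℝ) / N) ≤
          2 * codedRate M N K * F) := by
  have hN' : (0 : ℝ) < N := by exact_mod_cast hN
  have hR := codedRate_nonneg K hN hM
  by_cases h0 : K = 0 ∨ (N : ℝ) ≤ M
  · filter_upwards [codedScheme_eventually K hN hM hε] with F ⟨T, hT⟩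
    refine ⟨T, hT.trans (uniformProb_mono fun ω hω => ⟨hω.1, hω.2.1, hω.2.2, ?_⟩)⟩
    refine Scheme.expectedLoad_le hN _ fun d => ?_
    rw [codedScheme_load_eq_zero ω.1 ω.2 d]
    · push_cast; positivity
    · refine h0.imp_right fun hMN => min_eq_right (Nat.le_floor ?_)
      rw [le_div_iff₀ hN', mul_comm]
      gcongr
  · push Not at h0
    have hpos := codedRate_pos (Nat.pos_of_ne_zero h0.1) hM h0.2
    filter_upwards [codedScheme_eventually K hN hM (lt_min hε hpos)] with F ⟨T, hT⟩
    have h1 : min ε (codedRate M N K) ≤ ε := min_le_left _ _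
    have h2 : min ε (codedRate M N K) ≤ codedRate M N K := min_le_right _ _
    refine ⟨T, le_trans (by linarith) (hT.trans (uniformProb_mono fun ω hω =>
      ⟨hω.1, hω.2.1, fun d => (hω.2.2 d).trans (by gcongr), ?_⟩))⟩
    refine Scheme.expectedLoad_le hN _ fun d => (hω.2.2 d).trans ?_
    gcongr
    linarith

end CodedCaching

theorem mainTheorem3 :
    ∃ c : ℝ, 0 < c ∧
      ∀ (N K : ℕ) (M : ℝ) (p : Fin N → ℝ), 0 ≤ M →
        (∀ n n', p n = p n') → ∑ n, p n = 1 →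
        -- the optimal expected rate
        (CodedCaching.codedRate M N K / c ≤ CodedCaching.optExpectedRate M p K ∧
          CodedCaching.optExpectedRate M p K ≤ CodedCaching.codedRate M N K) ∧
        -- optimal peak rate against optimal expected rate
        (CodedCaching.optExpectedRate M p K ≤ CodedCaching.optPeakRate M N K ∧
          CodedCaching.optPeakRate M N K ≤ CodedCaching.codedRate M N K ∧
          CodedCaching.optPeakRate M N K ≤ c * CodedCaching.optExpectedRate M p K) ∧
        -- the coded caching scheme, with high probability for large file size
        (∀ ε : ℝ, 0 < ε → ∀ᶠ F : ℕ in Filter.atTop, ∃ T : ℕ,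
          1 - ε ≤ CodedCaching.uniformProb
            (CodedCaching.Placement N K F (CodedCaching.cachedBits M N F) ×
              CodedCaching.Coeffs N F T)
            (fun ω =>
              (CodedCaching.codedScheme ω.1 ω.2).FitsMemory M ∧
              (CodedCaching.codedScheme ω.1 ω.2).Decodable ∧
              (∀ d, ((CodedCaching.codedScheme ω.1 ω.2).load d : ℝ) ≤
                (CodedCaching.codedRate M N K + ε) * F) ∧
              (CodedCaching.codedScheme ω.1 ω.2).expectedLoad p ≤
                c * CodedCaching.optExpectedRate M p K * F)) := by
  -- `144 = 2 * 72`: the factor of the scheme over `codedRate` times that of `codedRate` over the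
  -- optimum.
  refine ⟨144, by norm_num, fun N K M p hM hp hsum => ?_⟩
  have hN : 0 < N := by
    rcases N.eq_zero_or_pos with rfl | h
    · simp at hsum
    · exact h
  have hN' : (0 : ℝ) < N := by exact_mod_cast hN
  obtain rfl : p = fun _ => (1 : ℝ) / N := by
    funext n
    rw [Finset.sum_congr rfl fun n' _ => hp n' n] at hsum
    simp only [Finset.sum_const, Finset.card_univ, Fintype.card_fin, nsmul_eq_mul] at hsum
    rw [eq_div_iff hN'.ne', mul_comm]
    exact hsum
  obtain ⟨h1, h2, h3⟩ := CodedCaching.optRates_bounds K hN hM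
  have h0 := CodedCaching.codedRate_nonneg K hN hM
  refine ⟨⟨by linarith, h2.trans h3⟩, ⟨h2, h3, by linarith⟩, fun ε hε => ?_⟩
  filter_upwards [CodedCaching.codedScheme_eventually_expectedLoad K hN hM hε] with F ⟨T, hT⟩
  refine ⟨T, hT.trans (CodedCaching.uniformProb_mono fun ω hω =>
    ⟨hω.1, hω.2.1, hω.2.2.1, hω.2.2.2.trans
      (mul_le_mul_of_nonneg_right (by linarith) (Nat.cast_nonneg F))⟩)⟩
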